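/- Let $G$ be a finite simple graph, let $d$ be a non-negative integer, and suppose that $G$ is $d$-regular and Vizing-class-2, i.e. its chromatic index is $\chi'(G)=d+1$. Let \[ r=\min\{|c^{-1}(d+1)| : c:E(G)\to\{1,\dots,d+1\}\text{ is a proper edge coloring of }G\} \] be the resistance of $G$. If $r\ge 2$ and $\operatorname{girth}(G)\ge 6r-5$ (every cycle of $G$ has length at least $6r-5$), then \[ \eta'_p(G)\le 2d = 2\chi'(G)-2 . \] Here two distinct edges are incident if they share an endpoint, $N'(e)$ is the set of edges incident to $e$, and the proper additive chromatic index $\eta'_p(G)$ is the least $k$ for which there is a proper edge coloring $c:E(G)\to\{1,\dots,k\}$ such that $\sum_{f\in N'(e_1)}c(f)\ne\sum_{f\in N'(e_2)}c(f)$ for any two incident edges $e_1,e_2$. -/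

import Mathlib

namespace SimpleGraph

/-- The chromatic index `χ'(G)`: the chromatic number of the line graph. -/
noncomputable def edgeChromaticIndex {V : Type*} (G : SimpleGraph V) : ℕ∞ :=
  G.lineGraph.chromaticNumber

/-- A `d`-regular graph is Vizing-class-2 if its chromatic index is `d + 1`. -/
def IsRegularVizingClassTwo {V : Type*} (G : SimpleGraph V) [G.LocallyFinite] (d : ℕ) : Prop :=
  G.IsRegularOfDegree d ∧ G.edgeChromaticIndex = d + 1

/-- `c` is a proper edge coloring of `G` with labels from `{1, ..., k}`: distinct edges that share
an endpoint get distinct labels. -/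
def IsProperEdgeColoring {V : Type*} (G : SimpleGraph V) (k : ℕ) (c : G.edgeSet → ℕ) : Prop :=
  (∀ e, 1 ≤ c e ∧ c e ≤ k) ∧ ∀ e f, G.lineGraph.Adj e f → c e ≠ c f

open Classical in
/-- The sum of the labels `c f` over the set `N'(e)` of the edges `f` incident to the edge `e`
(that is, `f ≠ e` and `f` shares an endpoint with `e`). -/
noncomputable def incidentEdgeSum {V : Type*} [Fintype V] (G : SimpleGraph V)
    (c : G.edgeSet → ℕ) (e : G.edgeSet) : ℕ :=
  ∑ f : G.edgeSet with G.lineGraph.Adj e f, c f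

/-- `c` is additive: any two incident edges have different sums of labels of incident edges. -/
def IsAdditiveEdgeColoring {V : Type*} [Fintype V] (G : SimpleGraph V)
    (c : G.edgeSet → ℕ) : Prop :=
  ∀ e f, G.lineGraph.Adj e f → G.incidentEdgeSum c e ≠ G.incidentEdgeSum c f

/-- The proper additive chromatic index `η'_p(G)`: the least `k` such that `G` has a proper
additive edge coloring with labels from `{1, ..., k}` (`⊤` if there were no such `k`). -/
noncomputable def properAdditiveChromaticIndex {V : Type*} [Fintype V]
    (G : SimpleGraph V) : ℕ∞ :=
  ⨅ (k : ℕ) (_ : ∃ c : G.edgeSet → ℕ, G.IsProperEdgeColoring k c ∧ G.IsAdditiveEdgeColoring c),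
    (k : ℕ∞)

/-- The resistance of a `d`-regular Vizing-class-2 graph: the minimum size of the color class of
`d + 1` over all proper edge colorings with labels from `{1, ..., d + 1}` (such colorings exist
for Vizing-class-2 graphs). -/
noncomputable def resistance {V : Type*} (G : SimpleGraph V) (d : ℕ) : ℕ :=
  sInf {m : ℕ | ∃ c : G.edgeSet → ℕ, G.IsProperEdgeColoring (d + 1) c ∧
    {e : G.edgeSet | c e = d + 1}.ncard = m}

end SimpleGraph

/-! Replace each color `i ≤ d` by the odd label `2 * i - 1`, and give each edge of color `d + 1` a
label 2 or 4. With `S` the sum of labels at a vertex, the edges `uv` and `uw` have equal sums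
exactly when `S v + 2 c(uw) = S w + 2 c(uv)`. If neither `v` nor `w` meets color `d + 1`, then `S v
= S w` and properness forbids this; if exactly one does, parity forbids it. Only pairs of last-color
edges joined by a path of length two through `u` remain.

If each last-color edge is near at most one other, these pairs can be treated independently. Girth
at least 7 leaves at most two forbidden values for the sum of the two labels, out of 4, 6, 8, when
the pair is joined by an edge, and at most one forbidden relation otherwise (`exists_pair_labels`).

Such a sparse last class comes from minimizing total nearness over colorings with exactly `r` edges
of color `d + 1` (`exists_coloring_near_matching`). By minimality of `r`, the ends of a last-color
edge are joined by a Kempe chain, and the edge can be moved along it (`exists_shift`). The girth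
makes the chain long and lets every other last-color edge obstruct only a few positions, so an edge
near two others can be moved to a better place. -/

namespace SimpleGraph

/-! ### Uniqueness of short paths, and the absence of short cycles -/

variable {V : Type*} {G : SimpleGraph V}

/-- Two paths with the same ends whose total length is below the girth coincide. -/
theorem Walk.IsPath.eq_of_length_add_lt_egirth {u v : V} {p q : G.Walk u v} (hp : p.IsPath)
    (hq : q.IsPath) (h : ((p.length + q.length : ℕ) : ℕ∞) < G.egirth) : p = q := by
  by_contra hne
  obtain ⟨_, _, p', q', hp', hq', hc⟩ := hp.exists_isCycle_of_ne hq hne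
  have h1 := egirth_le_length hc
  rw [Walk.length_append, Walk.length_reverse] at h1
  have h2 : ((p'.length + q'.length : ℕ) : ℕ∞) ≤ ((p.length + q.length : ℕ) : ℕ∞) := by
    exact_mod_cast Nat.add_le_add
      (Walk.length_le_of_isSubwalk hp') (Walk.length_le_of_isSubwalk hq')
  exact absurd (h1.trans h2) (not_le.2 h)

/-- In a graph of maximum degree two, paths with the same ends coincide if they leave the first
end in the same direction. -/
theorem Walk.IsPath.eq_of_forall_adj {x : V}
    (hdeg : ∀ v a b c, G.Adj v a → G.Adj v b → G.Adj v c → a = b ∨ b = c ∨ a = c) :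
    ∀ {u : V} (p q : G.Walk u x), p.IsPath → q.IsPath →
      (∀ a b, G.Adj u a → G.Adj u b → a ∈ p.support → b ∈ q.support → a = b) → p = q := by
  intro u p
  induction p with
  | nil =>
    intro q _ hq _
    exact ((Walk.eq_nil_iff_nil.2 (Walk.isPath_iff_nil.1 hq))).symm
  | @cons u v w h p ih =>
    intro q hp hq hu
    cases q with
    | nil => exact absurd (Walk.isPath_iff_nil.1 hp) (by simp)
    | @cons _ v' _ h' q =>
      obtain rfl : v = v' := hu _ _ h h' (by simp) (by simp)
      rw [Walk.cons_isPath_iff] at hp hq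
      rw [ih q hp.1 hq.1]
      intro a b ha hb hap hbq
      rcases hdeg v a b u ha hb h.symm with h1 | h1 | h1
      · exact h1
      · exact absurd (h1 ▸ hbq) hq.2
      · exact absurd (h1 ▸ hap) hp.2

theorem not_triangle_of_egirth (hg : 7 ≤ G.egirth) {a b c : V} (hab : G.Adj a b) (hbc : G.Adj b c) :
    ¬ G.Adj a c := by
  intro hac
  have h1 : (Walk.cons hab (Walk.cons hbc Walk.nil)).IsPath := by
    simp [Walk.cons_isPath_iff, hab.ne, hbc.ne, hac.ne]
  have h2 : (Walk.cons hac Walk.nil).IsPath := by simp [Walk.cons_isPath_iff, hac.ne]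
  have := congrArg Walk.length (h1.eq_of_length_add_lt_egirth h2 (lt_of_lt_of_le (by norm_num) hg))
  simp at this

theorem eq_of_common_neighbors_of_egirth (hg : 7 ≤ G.egirth) {a b b' c : V} (hac : a ≠ c)
    (hab : G.Adj a b)
    (hbc : G.Adj b c) (hab' : G.Adj a b') (hbc' : G.Adj b' c) : b = b' := by
  have h1 : (Walk.cons hab (Walk.cons hbc Walk.nil)).IsPath := by
    simp [Walk.cons_isPath_iff, hab.ne, hbc.ne, hac]
  have h2 : (Walk.cons hab' (Walk.cons hbc' Walk.nil)).IsPath := by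
    simp [Walk.cons_isPath_iff, hab'.ne, hbc'.ne, hac]
  have := congrArg Walk.support
    (h1.eq_of_length_add_lt_egirth h2 (lt_of_lt_of_le (by norm_num) hg))
  simpa using this

theorem not_pentagon_of_egirth (hg : 7 ≤ G.egirth) {a b c d e : V} (hab : G.Adj a b)
    (hbc : G.Adj b c) (hcd : G.Adj c d) (hae : G.Adj a e) (hed : G.Adj e d) (hac : a ≠ c) (had : a ≠ d)
    (hbd : b ≠ d) : False := by
  have h1 : (Walk.cons hab (Walk.cons hbc (Walk.cons hcd Walk.nil))).IsPath := by
    simp [Walk.cons_isPath_iff, hab.ne, hbc.ne, hac, hcd.ne, had, hbd]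
  have h2 : (Walk.cons hae (Walk.cons hed Walk.nil)).IsPath := by
    simp [Walk.cons_isPath_iff, hae.ne, hed.ne, had]
  have := congrArg Walk.length
    (h1.eq_of_length_add_lt_egirth h2 (lt_of_lt_of_le (by norm_num) hg))
  simp at this

theorem eq_of_hexagon_of_egirth (hg : 7 ≤ G.egirth) {a b c d e f : V} (hab : G.Adj a b) (hbc : G.Adj b c)
    (hcd : G.Adj c d) (haf : G.Adj a f) (hfe : G.Adj f e) (hed : G.Adj e d) (hac : a ≠ c)
    (had : a ≠ d) (hbd : b ≠ d) (hae : a ≠ e) (hfd : f ≠ d) : b = f := by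
  have h1 : (Walk.cons hab (Walk.cons hbc (Walk.cons hcd Walk.nil))).IsPath := by
    simp [Walk.cons_isPath_iff, hab.ne, hbc.ne, hac, hcd.ne, had, hbd]
  have h2 : (Walk.cons haf (Walk.cons hfe (Walk.cons hed Walk.nil))).IsPath := by
    simp [Walk.cons_isPath_iff, haf.ne, hfe.ne, hae, hed.ne, had, hfd]
  have := congrArg Walk.support
    (h1.eq_of_length_add_lt_egirth h2 (lt_of_lt_of_le (by norm_num) hg))
  simp at this
  exact this.1

end SimpleGraph

/-! ### Nearness of edges, and its total along a path -/

namespace SimpleGraph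

variable {V : Type*} {G : SimpleGraph V}

/-- Two pairs of vertices are near if some walk of length at most two joins them. -/
def EdgesNear (G : SimpleGraph V) (e f : Sym2 V) : Prop :=
  ∃ v ∈ e, ∃ w ∈ f, ∃ p : G.Walk v w, p.length ≤ 2

/-- Two pairs of vertices touch if they have a common vertex. -/
def EdgesTouch (e f : Sym2 V) : Prop := ∃ v, v ∈ e ∧ v ∈ f

theorem EdgesNear.symm {e f : Sym2 V} : G.EdgesNear e f → G.EdgesNear f e := by
  rintro ⟨v, hv, w, hw, p, hp⟩
  exact ⟨w, hw, v, hv, p.reverse, by simpa using hp⟩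

theorem EdgesTouch.symm {e f : Sym2 V} : EdgesTouch e f → EdgesTouch f e := by
  rintro ⟨v, hv, hw⟩
  exact ⟨v, hw, hv⟩

theorem EdgesTouch.near {e f : Sym2 V} : EdgesTouch e f → G.EdgesNear e f := by
  rintro ⟨v, hv, hw⟩
  exact ⟨v, hv, v, hw, Walk.nil, by simp⟩

theorem Walk.IsPath.exists_subpath {u x : V} {P : G.Walk u x} (hP : P.IsPath) {i j : ℕ}
    (hij : i ≤ j) (hj : j ≤ P.length) :
    ∃ Q : G.Walk (P.getVert i) (P.getVert j), Q.IsPath ∧ Q.length = j - i ∧ Q.edges ⊆ P.edges := by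
  have h : (P.drop i).getVert (j - i) = P.getVert j := by
    rw [Walk.drop_getVert]; congr 1; omega
  refine ⟨((P.drop i).take (j - i)).copy rfl h, ?_, ?_, ?_⟩
  · simpa using (hP.drop i).take (j - i)
  · simp only [Walk.length_copy, Walk.take_length, Walk.drop_length]; omega
  · rw [Walk.edges_copy]
    exact (((P.drop i).isSubwalk_take _).trans (P.isSubwalk_drop i)).edges_subset

/-- On a path that avoids the edge `f`, vertices within distance two of `f` are close to each
other, unless they close up a cycle. -/
theorem Walk.IsPath.sub_le_four_of_near {u x : V} {P : G.Walk u x} (hP : P.IsPath) {f : Sym2 V}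
    (hf : f ∈ G.edgeSet) (hfP : f ∉ P.edges) {i j : ℕ} (hij : i ≤ j) (hj : j ≤ P.length)
    (hg : ((j - i + 5 : ℕ) : ℕ∞) < G.egirth)
    (hi : ∃ w ∈ f, ∃ p : G.Walk (P.getVert i) w, p.length ≤ 2)
    (hj' : ∃ w ∈ f, ∃ p : G.Walk (P.getVert j) w, p.length ≤ 2) : j - i ≤ 4 := by
  classical
  obtain ⟨Q, hQ, hQl, hQe⟩ := hP.exists_subpath hij hj
  obtain ⟨w, hw, p, hp⟩ := hi
  obtain ⟨w', hw', q, hq⟩ := hj'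
  obtain ⟨m, hml, hme⟩ : ∃ m : G.Walk w w', m.length ≤ 1 ∧ m.edges ⊆ [f] := by
    by_cases hww : w = w'
    · subst hww
      exact ⟨Walk.nil, by simp, by simp⟩
    · have hfe : f = s(w, w') := ((Sym2.mem_and_mem_iff hww).1 ⟨hw, hw'⟩)
      have ha : G.Adj w w' := G.mem_edgeSet.1 (hfe ▸ hf)
      exact ⟨Walk.cons ha Walk.nil, by simp, by simp [hfe]⟩
  -- A detour through `f` of length at most 2 + 1 + 2 = 5.
  set W := (p.append m).append q.reverse with hW
  have hWl : W.bypass.length ≤ 5 := by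
    refine W.length_bypass_le_length.trans ?_
    simp only [hW, Walk.length_append, Walk.length_reverse]
    omega
  have hlt : ((Q.length + W.bypass.length : ℕ) : ℕ∞) < G.egirth :=
    lt_of_le_of_lt (by exact_mod_cast (by omega)) hg
  have hQW : Q = W.bypass := hQ.eq_of_length_add_lt_egirth W.bypass_isPath hlt
  -- The path avoids `f`, so all its edges come from `p` and `q`, which have at most four together.
  have hsub : Q.edges.toFinset ⊆ p.edges.toFinset ∪ q.edges.toFinset := by
    intro e he
    rw [List.mem_toFinset] at he
    have hne : e ≠ f := fun h => hfP (h ▸ hQe he)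
    rw [hQW] at he
    have := W.edges_bypass_subset_edges he
    simp only [hW, Walk.edges_append, Walk.edges_reverse, List.mem_append, List.mem_reverse] at this
    rcases this with (h | h) | h
    · simp [h]
    · exact absurd (List.mem_singleton.1 (hme h)) hne
    · simp [h]
  have hc := (Finset.card_le_card hsub).trans (Finset.card_union_le _ _)
  rw [List.toFinset_card_of_nodup hQ.isTrail.edges_nodup, Walk.length_edges, hQl] at hc
  have h1 := List.toFinset_card_le p.edges
  have h2 := List.toFinset_card_le q.edges
  rw [Walk.length_edges] at h1 h2
  omega

/-- Otherwise `f` is a chord that closes a short cycle with the path. -/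
theorem Walk.IsPath.eq_of_mem_edge {u x : V} {P : G.Walk u x} (hP : P.IsPath) {f : Sym2 V}
    (hf : f ∈ G.edgeSet) (hfP : f ∉ P.edges) {i j : ℕ} (hij : i ≤ j) (hj : j ≤ P.length)
    (hg : ((j - i + 1 : ℕ) : ℕ∞) < G.egirth) (hi : P.getVert i ∈ f) (hj' : P.getVert j ∈ f) :
    i = j := by
  by_contra hne
  obtain ⟨Q, hQ, hQl, hQe⟩ := hP.exists_subpath hij hj
  have hvne : P.getVert i ≠ P.getVert j := fun h =>
    hne (hP.getVert_injOn (by simp; omega) (by simpa using hj) h)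
  have hfe : f = s(P.getVert i, P.getVert j) := (Sym2.mem_and_mem_iff hvne).1 ⟨hi, hj'⟩
  have ha : G.Adj (P.getVert i) (P.getVert j) := G.mem_edgeSet.1 (hfe ▸ hf)
  have h1 : (Walk.cons ha Walk.nil).IsPath := by simp [Walk.cons_isPath_iff, hvne]
  have hQW := hQ.eq_of_length_add_lt_egirth h1 (by simpa [hQl] using hg)
  apply hfP
  apply hQe
  rw [hQW, hfe]
  simp

/-- Here `A i` stands for "the `i`-th vertex is near `f`", and the edges with a near end are
counted. Without a pair at distance at least `n - 1`, the near vertices lie in a window of five,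
which meets six edges. With such a pair `p`, `q`, the near vertices are at the two ends of the
range, except possibly one within 4 of both `p` and `q`; as `n ≥ 9`, it can only be `p + 4`. Again
six edges suffice. -/
theorem card_filter_or_succ_le_six {n : ℕ} (hn : 9 ≤ n) (A : ℕ → Prop) [DecidablePred A]
    (hA : ∀ i j, 1 ≤ i → i ≤ j → j ≤ n + 1 → A i → A j → j - i ≤ 4 ∨ n - 1 ≤ j - i) :
    ((Finset.Icc 1 n).filter fun i => A i ∨ A (i + 1)).card ≤ 6 := by
  by_cases h : ∃ p q, 1 ≤ p ∧ q ≤ n + 1 ∧ A p ∧ A q ∧ p + (n - 1) ≤ q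
  · obtain ⟨p, q, hp, hq, hAp, hAq, hpq⟩ := h
    have key : ∀ k, 1 ≤ k → k ≤ n + 1 → A k →
        k = 1 ∨ k = 2 ∨ k = n ∨ k = n + 1 ∨ k = p + 4 := by
      intro k hk1 hk2 hk
      rcases le_total p k with h1 | h1 <;> rcases le_total k q with h2 | h2
      · have := hA p k hp h1 hk2 hAp hk
        have := hA k q hk1 h2 hq hk hAq
        omega
      all_goals omega
    refine le_trans (Finset.card_le_card (t := {1, 2, n - 1, n, p + 3, p + 4}) ?_)
      Finset.card_le_six
    intro i hi
    simp only [Finset.mem_filter, Finset.mem_Icc] at hi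
    obtain ⟨⟨h1, h2⟩, h3 | h3⟩ := hi
    · have := key i h1 (by omega) h3
      simp only [Finset.mem_insert, Finset.mem_singleton]
      omega
    · have := key (i + 1) (by omega) (by omega) h3
      simp only [Finset.mem_insert, Finset.mem_singleton]
      omega
  · push Not at h
    by_cases he : ∃ m, 1 ≤ m ∧ m ≤ n + 1 ∧ A m
    · obtain ⟨h1, h2, h3⟩ := Nat.find_spec he
      have hmin : ∀ k, 1 ≤ k → k ≤ n + 1 → A k → Nat.find he ≤ k :=
        fun k a b c => Nat.find_min' he ⟨a, b, c⟩
      generalize Nat.find he = m at *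
      refine le_trans (Finset.card_le_card (t := Finset.Icc (m - 1) (m + 4)) ?_)
        (by rw [Nat.card_Icc]; omega)
      intro i hi
      simp only [Finset.mem_filter, Finset.mem_Icc] at hi ⊢
      obtain ⟨⟨h1', h2'⟩, h3' | h3'⟩ := hi
      · have a := hmin i h1' (by omega) h3'
        have b := hA m i h1 a (by omega) h3 h3'
        have c := h m i h1 (by omega) h3 h3'
        omega
      · have a := hmin (i + 1) (by omega) (by omega) h3'
        have b := hA m (i + 1) h1 a (by omega) h3 h3'
        have c := h m (i + 1) h1 (by omega) h3 h3'
        omega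
    · push Not at he
      rw [Finset.filter_false_of_mem]
      · simp
      · intro i hi
        rw [Finset.mem_Icc] at hi
        rintro (h1 | h1)
        · exact he i hi.1 (by omega) h1
        · exact he (i + 1) (by omega) (by omega) h1

theorem card_filter_or_succ_le_two {n : ℕ} (A : ℕ → Prop) [DecidablePred A]
    (hA : ∀ i j, 1 ≤ i → i ≤ j → j ≤ n + 1 → A i → A j → i = j) :
    ((Finset.Icc 1 n).filter fun i => A i ∨ A (i + 1)).card ≤ 2 := by
  by_cases he : ∃ m, 1 ≤ m ∧ m ≤ n + 1 ∧ A m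
  · obtain ⟨m, h1, h2, h3⟩ := he
    have key : ∀ k, 1 ≤ k → k ≤ n + 1 → A k → k = m := by
      intro k a b c
      rcases le_total k m with h | h
      · exact hA k m a h h2 c h3
      · exact (hA m k h1 h b h3 c).symm
    refine le_trans (Finset.card_le_card (t := {m - 1, m}) ?_) Finset.card_le_two
    intro i hi
    simp only [Finset.mem_filter, Finset.mem_Icc] at hi
    simp only [Finset.mem_insert, Finset.mem_singleton]
    obtain ⟨⟨h1', h2'⟩, h3' | h3'⟩ := hi
    · exact Or.inr (key i h1' (by omega) h3')
    · have := key (i + 1) (by omega) (by omega) h3'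
      omega
  · push Not at he
    rw [Finset.filter_false_of_mem]
    · simp
    · intro i hi
      rw [Finset.mem_Icc] at hi
      rintro (h1 | h1)
      · exact he i hi.1 (by omega) h1
      · exact he (i + 1) (by omega) (by omega) h1

open Classical in
/-- The weight that measures how much two edges obstruct each other. -/
noncomputable def edgeWeight (G : SimpleGraph V) (e f : Sym2 V) : ℕ :=
  (if G.EdgesNear e f then 1 else 0) + if EdgesTouch e f then 1 else 0

theorem edgeWeight_comm (e f : Sym2 V) : G.edgeWeight e f = G.edgeWeight f e := by
  unfold edgeWeight
  rw [(⟨EdgesNear.symm, EdgesNear.symm⟩ : G.EdgesNear e f ↔ G.EdgesNear f e),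
    (⟨EdgesTouch.symm, EdgesTouch.symm⟩ : EdgesTouch e f ↔ EdgesTouch f e)]

theorem edgeWeight_self (e : Sym2 V) : G.edgeWeight e e = 2 := by
  have h : EdgesTouch e e := by
    induction e with
    | h a b => exact ⟨a, by simp, by simp⟩
  simp [edgeWeight, h, EdgesTouch.near (G := G) h]

theorem edgeWeight_pos {e f : Sym2 V} : G.EdgesNear e f → 1 ≤ G.edgeWeight e f := by
  intro h
  simp [edgeWeight, h]

theorem not_touch_of_edgeWeight_le_one {e f : Sym2 V} (h : G.edgeWeight e f ≤ 1) :
    ¬ EdgesTouch e f := by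
  intro ht
  simp [edgeWeight, ht, EdgesTouch.near (G := G) ht] at h

/-- Along a path that avoids `f`, the total weight of the edges with respect to `f` is small. -/
theorem Walk.IsPath.sum_edgeWeight_le {u x : V} {P : G.Walk u x} (hP : P.IsPath) {f : Sym2 V}
    (hf : f ∈ G.edgeSet) (hfP : f ∉ P.edges) {n : ℕ} (hn : 9 ≤ n) (hnP : n + 1 ≤ P.length)
    (hg : ((n + 4 : ℕ) : ℕ∞) ≤ G.egirth) :
    ∑ i ∈ Finset.Icc 1 n, G.edgeWeight s(P.getVert i, P.getVert (i + 1)) f ≤ 8 := by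
  classical
  -- The bound 8 is 6 from near edges plus 2 from touching edges.
  unfold edgeWeight
  rw [Finset.sum_add_distrib, ← Finset.card_filter, ← Finset.card_filter]
  have h1 := card_filter_or_succ_le_six hn
    (fun i => ∃ w ∈ f, ∃ p : G.Walk (P.getVert i) w, p.length ≤ 2) (by
      intro i j hi hij hj hAi hAj
      by_cases h : n - 1 ≤ j - i
      · exact Or.inr h
      · refine Or.inl (hP.sub_le_four_of_near hf hfP hij (by omega)
          (lt_of_lt_of_le ?_ hg) hAi hAj)
        exact_mod_cast (by omega))
  have h2 := card_filter_or_succ_le_two (n := n) (fun i => P.getVert i ∈ f) (by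
      intro i j hi hij hj hAi hAj
      refine hP.eq_of_mem_edge hf hfP hij (by omega) (lt_of_lt_of_le ?_ hg) hAi hAj
      exact_mod_cast (by omega))
  have h3 : ((Finset.Icc 1 n).filter fun i => G.EdgesNear s(P.getVert i, P.getVert (i + 1)) f).card
      ≤ 6 := by
    simpa [EdgesNear] using h1
  have h4 : ((Finset.Icc 1 n).filter fun i => EdgesTouch s(P.getVert i, P.getVert (i + 1)) f).card
      ≤ 2 := by
    refine le_trans (Finset.card_le_card fun i hi => ?_) h2
    rw [Finset.mem_filter] at hi ⊢
    obtain ⟨hi1, v, hv, hvf⟩ := hi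
    rcases Sym2.mem_iff.1 hv with rfl | rfl
    · exact ⟨hi1, Or.inl hvf⟩
    · exact ⟨hi1, Or.inr hvf⟩
  omega

end SimpleGraph

/-! ### Kempe swaps, and moving an edge of the last color -/

namespace SimpleGraph

variable {V : Type*} {G : SimpleGraph V}

/-- A labelling of the unordered pairs of vertices that restricts to a proper edge coloring with
colors from `{1, ..., k}`. -/
structure IsProperPairColoring (G : SimpleGraph V) (k : ℕ) (C : Sym2 V → ℕ) : Prop where
  one_le : ∀ {u v}, G.Adj u v → 1 ≤ C s(u, v)
  le : ∀ {u v}, G.Adj u v → C s(u, v) ≤ k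
  ne : ∀ {u v w}, G.Adj u v → G.Adj u w → v ≠ w → C s(u, v) ≠ C s(u, w)

/-- The subgraph formed by the edges of color `α` or `β`. -/
def kempeGraph (G : SimpleGraph V) (C : Sym2 V → ℕ) (α β : ℕ) : SimpleGraph V where
  Adj u v := G.Adj u v ∧ (C s(u, v) = α ∨ C s(u, v) = β)
  symm := ⟨fun u v h => ⟨h.1.symm, by rw [Sym2.eq_swap]; exact h.2⟩⟩

theorem kempeGraph_le {C : Sym2 V → ℕ} {α β : ℕ} : kempeGraph G C α β ≤ G := fun _ _ h => h.1

/-- If no Kempe chain joins the ends of an edge of the last color, a Kempe swap frees a smaller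
color for that edge. -/
theorem IsProperPairColoring.exists_recolor {d : ℕ} {C : Sym2 V → ℕ}
    (hC : G.IsProperPairColoring (d + 1) C) {x y : V} (hxy : G.Adj x y)
    (hCxy : C s(x, y) = d + 1) {α β : ℕ} (hα1 : 1 ≤ α) (hαd : α ≤ d) (hβ1 : 1 ≤ β) (hβd : β ≤ d)
    (hx : ∀ w, G.Adj x w → C s(x, w) ≠ α) (hy : ∀ w, G.Adj y w → C s(y, w) ≠ β)
    (hr : ¬ (kempeGraph G C α β).Reachable y x) :
    ∃ C', G.IsProperPairColoring (d + 1) C' ∧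
      ∀ f ∈ G.edgeSet, (C' f = d + 1 ↔ C f = d + 1 ∧ f ≠ s(x, y)) := by
  classical
  set K := fun v => (kempeGraph G C α β).Reachable y v with hK
  have hKy : K y := Reachable.refl y
  -- The swap on the component of `y` makes `α` missing at `y`; it stays missing at `x`, which lies
  -- outside. Other edges leaving the component have neither color, so asking for just one end in it
  -- is harmless.
  set C' : Sym2 V → ℕ := fun f => if f = s(x, y) then α else
    if ∃ v ∈ f, K v then Equiv.swap α β (C f) else C f with hC'
  have hval : ∀ u v, G.Adj u v → s(u, v) ≠ s(x, y) →
      C' s(u, v) = if K u then Equiv.swap α β (C s(u, v)) else C s(u, v) := by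
    intro u v huv hne
    simp only [hC', if_neg hne]
    by_cases hu : K u
    · rw [if_pos hu, if_pos ⟨u, by simp, hu⟩]
    · rw [if_neg hu]
      split_ifs with h
      · obtain ⟨z, hz, hzK⟩ := h
        rcases Sym2.mem_iff.1 hz with rfl | rfl
        · exact absurd hzK hu
        · have hcol : ¬ (C s(u, z) = α ∨ C s(u, z) = β) := fun hcol =>
            hu (hzK.trans (Adj.reachable
              (show (kempeGraph G C α β).Adj z u from
                ⟨huv.symm, by rw [Sym2.eq_swap]; exact hcol⟩)))
          push Not at hcol
          exact Equiv.swap_apply_of_ne_of_ne hcol.1 hcol.2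
      · rfl
  have hCxy' : C' s(x, y) = α := by simp [hC']
  have hend : ∀ u v w, G.Adj u v → G.Adj u w → v ≠ w → s(u, v) = s(x, y) →
      C' s(u, v) ≠ C' s(u, w) := by
    intro u v w huv huw hvw he
    have hne : s(u, w) ≠ s(x, y) := by
      rw [← he]
      intro h
      exact hvw (Sym2.congr_right.1 h).symm
    rw [hval u w huw hne, he, hCxy']
    have hu : u = x ∨ u = y := by
      have : u ∈ s(x, y) := he ▸ Sym2.mem_mk_left u v
      simpa using this
    rcases hu with rfl | rfl
    · rw [if_neg hr]
      exact (hx w huw).symm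
    · rw [if_pos hKy]
      intro h
      have := congrArg (Equiv.swap α β) h
      simp only [Equiv.swap_apply_left, Equiv.swap_apply_self] at this
      exact hy w huw this.symm
  have hswap : ∀ n, 1 ≤ n → n ≤ d + 1 →
      1 ≤ Equiv.swap α β n ∧ Equiv.swap α β n ≤ d + 1 ∧ (Equiv.swap α β n = d + 1 ↔ n = d + 1) := by
    intro n h1 h2
    rw [Equiv.swap_apply_def]
    split_ifs <;> omega
  refine ⟨C', ⟨?_, ?_, ?_⟩, ?_⟩
  · intro u v huv
    by_cases he : s(u, v) = s(x, y)
    · rw [he, hCxy']; exact hα1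
    · rw [hval u v huv he]
      split_ifs
      · exact (hswap _ (hC.one_le huv) (hC.le huv)).1
      · exact hC.one_le huv
  · intro u v huv
    by_cases he : s(u, v) = s(x, y)
    · rw [he, hCxy']; omega
    · rw [hval u v huv he]
      split_ifs
      · exact (hswap _ (hC.one_le huv) (hC.le huv)).2.1
      · exact hC.le huv
  · intro u v w huv huw hvw
    by_cases he : s(u, v) = s(x, y)
    · exact hend u v w huv huw hvw he
    by_cases he' : s(u, w) = s(x, y)
    · exact (hend u w v huw huv hvw.symm he').symm
    rw [hval u v huv he, hval u w huw he']
    split_ifs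
    · exact fun h => hC.ne huv huw hvw ((Equiv.swap α β).injective h)
    · exact hC.ne huv huw hvw
  · intro f hf
    induction f with
    | h u v =>
      have huv : G.Adj u v := hf
      by_cases he : s(u, v) = s(x, y)
      · rw [he, hCxy']
        simp only [ne_eq, not_true_eq_false, and_false, iff_false]
        omega
      · rw [hval u v huv he]
        simp only [ne_eq, he, not_false_eq_true, and_true]
        split_ifs
        · exact (hswap _ (hC.one_le huv) (hC.le huv)).2.2
        · rfl

/-- An edge of the last color can be moved along the Kempe chain that joins its ends. -/
theorem IsProperPairColoring.exists_shift {d : ℕ} {C : Sym2 V → ℕ}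
    (hC : G.IsProperPairColoring (d + 1) C) {x y : V} (hxy : G.Adj x y)
    (hCxy : C s(x, y) = d + 1) {α β : ℕ} (hα1 : 1 ≤ α) (hαd : α ≤ d) (hβ1 : 1 ≤ β) (hβd : β ≤ d)
    (hx : ∀ w, G.Adj x w → C s(x, w) ≠ α) (hy : ∀ w, G.Adj y w → C s(y, w) ≠ β)
    (P : (kempeGraph G C α β).Walk y x) (hP : P.IsPath) {i : ℕ} (hi : 1 ≤ i)
    (hiP : i + 1 < P.length)
    (ht : ∀ f ∈ G.edgeSet, C f = d + 1 → f ≠ s(x, y) →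
      ¬ EdgesTouch s(P.getVert i, P.getVert (i + 1)) f) :
    ∃ C', G.IsProperPairColoring (d + 1) C' ∧ ∀ f ∈ G.edgeSet,
      (C' f = d + 1 ↔ C f = d + 1 ∧ f ≠ s(x, y) ∨ f = s(P.getVert i, P.getVert (i + 1))) := by
  classical
  have hadj : (kempeGraph G C α β).Adj (P.getVert i) (P.getVert (i + 1)) :=
    P.adj_getVert_succ (by omega)
  have hends : ∀ j, 1 ≤ j → j < P.length → P.getVert j ≠ x ∧ P.getVert j ≠ y := by
    intro j h1 h2
    constructor
    · intro h
      have := hP.getVert_injOn (by simp; omega) (by simp) (h.trans P.getVert_length.symm)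
      omega
    · intro h
      have := hP.getVert_injOn (by simp; omega) (by simp) (h.trans P.getVert_zero.symm)
      omega
  have h1 := hends i hi (by omega)
  have h2 := hends (i + 1) (by omega) hiP
  have he'P : s(P.getVert i, P.getVert (i + 1)) ∈ P.edges :=
    P.mk_mem_edges_iff_exists.2 ⟨i, by omega, rfl⟩
  generalize P.getVert i = a at *
  generalize P.getVert (i + 1) = b at *
  have htouch : ∀ f ∈ G.edgeSet, C f = d + 1 → ¬ EdgesTouch s(a, b) f := by
    intro f hf hCf
    by_cases hfe : f = s(x, y)
    · rintro ⟨v, hv, hvf⟩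
      rw [hfe] at hvf
      rcases Sym2.mem_iff.1 hv with rfl | rfl <;> rcases Sym2.mem_iff.1 hvf with rfl | rfl <;>
        simp_all
    · exact ht f hf hCf hfe
  have hne : s(x, y) ≠ s(a, b) := by
    intro h
    have := Sym2.mem_iff.1 (h ▸ Sym2.mem_mk_left a b : a ∈ s(x, y))
    rcases this with h | h
    · exact h1.1 h
    · exact h1.2 h
  -- Giving the chain edge the last color cuts the chain, after which `xy` can be recolored by a
  -- swap.
  set C₁ := Function.update C s(a, b) (d + 1) with hC₁
  have hC₁e : C₁ s(a, b) = d + 1 := by simp [hC₁]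
  have hC₁ne : ∀ f, f ≠ s(a, b) → C₁ f = C f := fun f hf => by simp [hC₁, hf]
  have hprop : ∀ u v w, G.Adj u v → G.Adj u w → v ≠ w → s(u, v) = s(a, b) →
      C₁ s(u, v) ≠ C₁ s(u, w) := by
    intro u v w huv huw hvw he
    have hne' : s(u, w) ≠ s(a, b) := by
      rw [← he]
      intro h
      exact hvw (Sym2.congr_right.1 h).symm
    rw [hC₁ne _ hne', he, hC₁e]
    intro h
    exact htouch s(u, w) huw h.symm ⟨u, he ▸ Sym2.mem_mk_left u v, Sym2.mem_mk_left u w⟩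
  have hproper : G.IsProperPairColoring (d + 1) C₁ := by
    refine ⟨?_, ?_, ?_⟩
    · intro u v huv
      by_cases he : s(u, v) = s(a, b)
      · rw [he, hC₁e]; omega
      · rw [hC₁ne _ he]; exact hC.one_le huv
    · intro u v huv
      by_cases he : s(u, v) = s(a, b)
      · rw [he, hC₁e]
      · rw [hC₁ne _ he]; exact hC.le huv
    · intro u v w huv huw hvw
      by_cases he : s(u, v) = s(a, b)
      · exact hprop u v w huv huw hvw he
      by_cases he' : s(u, w) = s(a, b)
      · exact (hprop u w v huw huv hvw.symm he').symm
      rw [hC₁ne _ he, hC₁ne _ he']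
      exact hC.ne huv huw hvw
  have hmiss : ∀ v γ, γ ≤ d → (∀ w, G.Adj v w → C s(v, w) ≠ γ) →
      ∀ w, G.Adj v w → C₁ s(v, w) ≠ γ := by
    intro v γ hγ hv w hvw
    by_cases he : s(v, w) = s(a, b)
    · rw [he, hC₁e]; omega
    · rw [hC₁ne _ he]; exact hv w hvw
  have hle : kempeGraph G C₁ α β ≤ kempeGraph G C α β := by
    intro u v huv
    refine ⟨huv.1, ?_⟩
    have h := huv.2
    by_cases he : s(u, v) = s(a, b)
    · rw [he, hC₁e] at h; omega
    · rwa [hC₁ne _ he] at h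
  have hnr : ¬ (kempeGraph G C₁ α β).Reachable y x := by
    rintro ⟨Q₀⟩
    have hQ : (Q₀.bypass.mapLe hle).IsPath := Q₀.bypass_isPath.mapLe hle
    have hcol : ∀ v p q, (kempeGraph G C α β).Adj v p → (kempeGraph G C α β).Adj v q →
        C s(v, p) = C s(v, q) → p = q := by
      intro v p q hp hq h
      by_contra hpq
      exact hC.ne hp.1 hq.1 hpq h
    -- Kempe graphs have maximum degree two, and `y` has no edge of color `β`, so the chain from `y`
    -- to `x` is unique. A surviving path would thus contain the removed edge.
    have hPQ : P = Q₀.bypass.mapLe hle := by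
      refine Walk.IsPath.eq_of_forall_adj ?_ _ _ hP hQ ?_
      · intro v p q s hp hq hs
        rcases hp.2 with e1 | e1 <;> rcases hq.2 with e2 | e2 <;> rcases hs.2 with e3 | e3 <;>
        first
        | exact Or.inl (hcol v p q hp hq (e1.trans e2.symm))
        | exact Or.inr (Or.inl (hcol v q s hq hs (e2.trans e3.symm)))
        | exact Or.inr (Or.inr (hcol v p s hp hs (e1.trans e3.symm)))
      · intro p q hp hq _ _
        have e1 := hp.2.resolve_right (hy p hp.1)
        have e2 := hq.2.resolve_right (hy q hq.1)
        exact hcol y p q hp hq (e1.trans e2.symm)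
    rw [hPQ, Walk.edges_mapLe_eq_edges] at he'P
    have := (Q₀.bypass.adj_of_mem_edges he'P).2
    rw [hC₁e] at this
    omega
  obtain ⟨C', hC', hC's⟩ := hproper.exists_recolor hxy (by rw [hC₁ne _ hne, hCxy]) hα1 hαd hβ1 hβd
    (hmiss x α hαd hx) (hmiss y β hβd hy) hnr
  refine ⟨C', hC', fun f hf => ?_⟩
  rw [hC's f hf]
  by_cases he : f = s(a, b)
  · subst he
    simp [hC₁e, hne.symm]
  · rw [hC₁ne _ he]
    simp [he]

end SimpleGraph

/-! ### Minimizing nearness within the last color class -/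

namespace SimpleGraph

variable {V : Type*} {G : SimpleGraph V}

open Classical in
/-- The edges of color `k`. -/
noncomputable def colorClass [Fintype V] (G : SimpleGraph V) (C : Sym2 V → ℕ) (k : ℕ) :
    Finset (Sym2 V) :=
  Finset.univ.filter fun e => e ∈ G.edgeSet ∧ C e = k

theorem mem_colorClass [Fintype V] {C : Sym2 V → ℕ} {k : ℕ} {e : Sym2 V} :
    e ∈ G.colorClass C k ↔ e ∈ G.edgeSet ∧ C e = k := by
  simp [colorClass]

variable [Fintype V] [DecidableRel G.Adj] {d : ℕ} {C : Sym2 V → ℕ}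

theorem IsProperPairColoring.injOn_neighborFinset {k : ℕ} (hC : G.IsProperPairColoring k C)
    (x : V) : Set.InjOn (fun w => C s(x, w)) (G.neighborFinset x) := by
  intro v hv w hw h
  by_contra hvw
  simp only [Finset.mem_coe, mem_neighborFinset] at hv hw
  exact hC.ne hv hw hvw h

theorem IsProperPairColoring.image_neighborFinset [DecidableEq V]
    (hC : G.IsProperPairColoring (d + 1) C) {x : V} (hd : G.degree x = d)
    (hx : ∀ w, G.Adj x w → C s(x, w) ≠ d + 1) :
    (G.neighborFinset x).image (fun w => C s(x, w)) = Finset.Icc 1 d := by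
  refine Finset.eq_of_subset_of_card_le ?_ ?_
  · intro i hi
    obtain ⟨w, hw, rfl⟩ := Finset.mem_image.1 hi
    rw [mem_neighborFinset] at hw
    have := hC.one_le hw
    have := hC.le hw
    have := hx w hw
    rw [Finset.mem_Icc]
    omega
  · rw [Finset.card_image_of_injOn (hC.injOn_neighborFinset x), card_neighborFinset_eq_degree, hd,
      Nat.card_Icc]
    omega

/-- The other `d - 1` edges at `x` have distinct colors among `1, ..., d`, so just one color is
missing. -/
theorem IsProperPairColoring.exists_image_neighborFinset_erase [DecidableEq V]
    (hC : G.IsProperPairColoring (d + 1) C) {x y : V} (hd : G.degree x = d) (hxy : G.Adj x y)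
    (hCxy : C s(x, y) = d + 1) :
    ∃ m ∈ Finset.Icc 1 d, ((G.neighborFinset x).erase y).image (fun w => C s(x, w)) =
      (Finset.Icc 1 d).erase m := by
  have hinj : Set.InjOn (fun w => C s(x, w)) ((G.neighborFinset x).erase y) :=
    (hC.injOn_neighborFinset x).mono (by simp)
  have hy : y ∈ G.neighborFinset x := by simpa using hxy
  have hcard : (((G.neighborFinset x).erase y).image (fun w => C s(x, w))).card = d - 1 := by
    rw [Finset.card_image_of_injOn hinj, Finset.card_erase_of_mem hy, card_neighborFinset_eq_degree,
      hd]
  have hpos : 1 ≤ d := by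
    rw [← hd, ← card_neighborFinset_eq_degree]
    exact Finset.card_pos.2 ⟨y, hy⟩
  have hsub : ((G.neighborFinset x).erase y).image (fun w => C s(x, w)) ⊆ Finset.Icc 1 d := by
    intro i hi
    obtain ⟨w, hw, rfl⟩ := Finset.mem_image.1 hi
    rw [Finset.mem_erase, mem_neighborFinset] at hw
    have h1 := hC.one_le hw.2
    have h2 := hC.le hw.2
    have h3 := hC.ne hw.2 hxy hw.1
    rw [Finset.mem_Icc]
    omega
  obtain ⟨m, hm, hm'⟩ := Finset.exists_mem_notMem_of_card_lt_card
    (s := ((G.neighborFinset x).erase y).image (fun w => C s(x, w))) (t := Finset.Icc 1 d)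
    (by rw [hcard, Nat.card_Icc]; omega)
  refine ⟨m, hm, Finset.eq_of_subset_of_card_le ?_ ?_⟩
  · intro i hi
    exact Finset.mem_erase.2 ⟨fun h => hm' (h ▸ hi), hsub hi⟩
  · rw [hcard, Finset.card_erase_of_mem hm, Nat.card_Icc]
    omega

theorem IsProperPairColoring.exists_missing (hC : G.IsProperPairColoring (d + 1) C) {x y : V}
    (hd : G.degree x = d) (hxy : G.Adj x y) (hCxy : C s(x, y) = d + 1) :
    ∃ m, 1 ≤ m ∧ m ≤ d ∧ ∀ w, G.Adj x w → C s(x, w) ≠ m := by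
  classical
  obtain ⟨m, hm, h⟩ := hC.exists_image_neighborFinset_erase hd hxy hCxy
  rw [Finset.mem_Icc] at hm
  refine ⟨m, hm.1, hm.2, fun w hw hwm => ?_⟩
  by_cases hwy : w = y
  · subst hwy; omega
  · have : C s(x, w) ∈ (Finset.Icc 1 d).erase m := by
      rw [← h]
      exact Finset.mem_image.2 ⟨w, by simp [hwy, hw], rfl⟩
    exact (Finset.mem_erase.1 this).1 hwm

theorem sum_sum_insert {α : Type*} [DecidableEq α] (w : α → α → ℕ) (hw : ∀ a b, w a b = w b a)
    {T : Finset α} {a : α} (ha : a ∉ T) :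
    ∑ e ∈ insert a T, ∑ f ∈ insert a T, w e f =
      w a a + 2 * ∑ f ∈ T, w a f + ∑ e ∈ T, ∑ f ∈ T, w e f := by
  rw [Finset.sum_insert ha, Finset.sum_insert ha]
  have : ∑ e ∈ T, ∑ f ∈ insert a T, w e f = ∑ e ∈ T, w a e + ∑ e ∈ T, ∑ f ∈ T, w e f := by
    rw [← Finset.sum_add_distrib]
    refine Finset.sum_congr rfl fun e _ => ?_
    rw [Finset.sum_insert ha, hw]
  rw [this]
  ring

/-- Under a girth condition, a minimum color class can be chosen such that each of its edges is
near at most one other. -/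
theorem exists_coloring_near_matching {r : ℕ} (hd : ∀ v, G.degree v = d)
    (hmin : ∀ C, G.IsProperPairColoring (d + 1) C → r ≤ (G.colorClass C (d + 1)).card)
    (hex : ∃ C, G.IsProperPairColoring (d + 1) C ∧ (G.colorClass C (d + 1)).card = r)
    (hg : ((6 * r - 5 : ℕ) : ℕ∞) ≤ G.egirth) :
    ∃ C, G.IsProperPairColoring (d + 1) C ∧
      ∀ e ∈ G.colorClass C (d + 1), ∀ f ∈ G.colorClass C (d + 1), ∀ g ∈ G.colorClass C (d + 1),
        f ≠ e → g ≠ e → G.EdgesNear e f → G.EdgesNear e g → f = g := by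
  classical
  -- The sum runs over ordered pairs; the diagonal adds 2 per edge, hence is constant on classes of
  -- size `r`.
  set Φ : Finset (Sym2 V) → ℕ := fun S => ∑ e ∈ S, ∑ f ∈ S, G.edgeWeight e f with hΦ
  have hP : ∃ n, ∃ C, G.IsProperPairColoring (d + 1) C ∧ (G.colorClass C (d + 1)).card = r ∧
      Φ (G.colorClass C (d + 1)) = n := by
    obtain ⟨C, h1, h2⟩ := hex
    exact ⟨_, C, h1, h2, rfl⟩
  obtain ⟨C, hC, hcard, hCΦ⟩ := Nat.find_spec hP
  have hleast : ∀ C', G.IsProperPairColoring (d + 1) C' → (G.colorClass C' (d + 1)).card = r →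
      Φ (G.colorClass C (d + 1)) ≤ Φ (G.colorClass C' (d + 1)) := by
    intro C' h1 h2
    rw [hCΦ]
    exact Nat.find_min' hP ⟨C', h1, h2, rfl⟩
  refine ⟨C, hC, fun e he f hf g hg' hfe hge hnf hng => ?_⟩
  by_contra hfg
  set S := G.colorClass C (d + 1) with hS
  set T := S.erase e with hT
  have hST : S = insert e T := (Finset.insert_erase he).symm
  have hfT : f ∈ T := Finset.mem_erase.2 ⟨hfe, hf⟩
  have hgT : g ∈ T := Finset.mem_erase.2 ⟨hge, hg'⟩
  have heT : e ∉ T := Finset.notMem_erase e S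
  have hTcard : T.card + 1 = r := by
    rw [← hcard, ← Finset.card_insert_of_notMem heT, ← hST]
  have hT2 : 2 ≤ T.card := by
    rw [← Finset.card_pair hfg]
    exact Finset.card_le_card (by intro z hz; simp at hz; rcases hz with rfl | rfl <;> assumption)
  have hWe : 2 ≤ ∑ f ∈ T, G.edgeWeight e f := by
    calc 2 ≤ G.edgeWeight e f + G.edgeWeight e g := by
          have := edgeWeight_pos hnf
          have := edgeWeight_pos hng
          omega
      _ = ∑ z ∈ {f, g}, G.edgeWeight e z := (Finset.sum_pair hfg).symm
      _ ≤ _ := Finset.sum_le_sum_of_subset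
            (by intro z hz; simp at hz; rcases hz with rfl | rfl <;> assumption)
  have hmemT : ∀ z, z ∈ T ↔ z ∈ G.edgeSet ∧ C z = d + 1 ∧ z ≠ e := by
    intro z
    rw [hT, Finset.mem_erase, hS, mem_colorClass]
    tauto
  induction e with
  | h x y =>
  obtain ⟨hxy, hCxy⟩ := mem_colorClass.1 he
  rw [mem_edgeSet] at hxy
  obtain ⟨α, hα1, hαd, hx⟩ := hC.exists_missing (hd x) hxy hCxy
  obtain ⟨β, hβ1, hβd, hy⟩ := hC.exists_missing (hd y) hxy.symm (by rwa [Sym2.eq_swap])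
  have hreach : (kempeGraph G C α β).Reachable y x := by
    by_contra hr
    obtain ⟨C', hC', hs⟩ := hC.exists_recolor hxy hCxy hα1 hαd hβ1 hβd hx hy hr
    have hT' : G.colorClass C' (d + 1) = T := by
      ext z
      rw [mem_colorClass, hmemT]
      exact and_congr_right fun hz => hs z hz
    have := hmin C' hC'
    rw [hT'] at this
    omega
  obtain ⟨P₀⟩ := hreach
  set P := P₀.bypass with hPdef
  have hPp : P.IsPath := P₀.bypass_isPath
  set Q := P.mapLe kempeGraph_le with hQ
  have hQp : Q.IsPath := hPp.mapLe kempeGraph_le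
  have hQl : Q.length = P.length := by simp [hQ]
  have hQget : ∀ i, Q.getVert i = P.getVert i := by
    intro i
    simp [hQ, Walk.getVert_map]
  have hcolP : ∀ z ∈ P.edges, C z ≠ d + 1 := by
    intro z hz
    induction z with
    | h a b =>
      have := (P.adj_of_mem_edges hz).2
      omega
  have hQedges : ∀ z, C z = d + 1 → z ∉ Q.edges := by
    intro z hz hzQ
    rw [hQ, Walk.edges_mapLe_eq_edges] at hzQ
    exact hcolP z hzQ hz
  -- The chain and the edge `xy` form a cycle.
  have hlen : 6 * r - 5 ≤ Q.length + 1 := by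
    by_contra hlt
    have h1 : (Walk.cons hxy.symm Walk.nil).IsPath := by simp [Walk.cons_isPath_iff, hxy.ne']
    have hlt' : ((Q.length + (Walk.cons hxy.symm Walk.nil).length : ℕ) : ℕ∞) < G.egirth := by
      refine lt_of_lt_of_le ?_ hg
      simp only [Walk.length_cons, Walk.length_nil]
      exact_mod_cast (by omega)
    have := hQp.eq_of_length_add_lt_egirth h1 hlt'
    refine hQedges s(x, y) hCxy ?_
    rw [this]
    simp [Sym2.eq_swap]
  -- Averaging: weight at least 2 at all `6r - 9` positions would total at least `12r - 18`, but
  -- each of the `r - 1` edges of `T` contributes at most 8. This is impossible for `r ≥ 3`, which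
  -- holds since `T` contains `f` and `g`. The number of positions is the largest `n` for which `n +
  -- 4 ≤ 6r - 5`.
  obtain ⟨i, hi, hile⟩ : ∃ i ∈ Finset.Icc 1 (6 * r - 9),
      ∑ f ∈ T, G.edgeWeight s(Q.getVert i, Q.getVert (i + 1)) f ≤ 1 := by
    by_contra! hcon
    have h1 : (6 * r - 9) * 2 ≤ ∑ i ∈ Finset.Icc 1 (6 * r - 9), ∑ f ∈ T,
        G.edgeWeight s(Q.getVert i, Q.getVert (i + 1)) f := by
      have := Finset.card_nsmul_le_sum _ _ 2 hcon
      simpa [Nat.card_Icc] using this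
    rw [Finset.sum_comm] at h1
    have h2 := Finset.sum_le_card_nsmul T (fun f => ∑ i ∈ Finset.Icc 1 (6 * r - 9),
        G.edgeWeight s(Q.getVert i, Q.getVert (i + 1)) f) 8 (by
      intro f hf
      obtain ⟨hfE, hCf, _⟩ := (hmemT f).1 hf
      refine hQp.sum_edgeWeight_le hfE (hQedges f hCf) (by omega) (by omega) ?_
      rwa [show 6 * r - 9 + 4 = 6 * r - 5 by omega])
    rw [smul_eq_mul] at h2
    omega
  rw [Finset.mem_Icc] at hi
  rw [hQget, hQget] at hile
  -- Touching edges have weight 2, so weight at most 1 also ensures that the move keeps the coloring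
  -- proper.
  obtain ⟨C', hC', hs⟩ := hC.exists_shift hxy hCxy hα1 hαd hβ1 hβd hx hy P hPp hi.1 (by omega) (by
    intro f hfE hCf hfe
    have hfT : f ∈ T := (hmemT f).2 ⟨hfE, hCf, hfe⟩
    exact not_touch_of_edgeWeight_le_one
      ((Finset.single_le_sum (f := fun f => G.edgeWeight s(P.getVert i, P.getVert (i + 1)) f)
        (fun _ _ => Nat.zero_le _) hfT).trans hile))
  have hadj := P.adj_getVert_succ (i := i) (by omega)
  set e' := s(P.getVert i, P.getVert (i + 1)) with he'
  have he'T : e' ∉ T := fun h =>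
    hcolP e' (P.mk_mem_edges_iff_exists.2 ⟨i, by omega, rfl⟩) ((hmemT e').1 h).2.1
  have hS' : G.colorClass C' (d + 1) = insert e' T := by
    ext z
    rw [mem_colorClass, Finset.mem_insert, hmemT]
    constructor
    · rintro ⟨hz, hz'⟩
      rcases (hs z hz).1 hz' with h | h
      · exact Or.inr ⟨hz, h⟩
      · exact Or.inl h
    · rintro (rfl | ⟨hz, h⟩)
      · exact ⟨hadj.1, (hs _ hadj.1).2 (Or.inr rfl)⟩
      · exact ⟨hz, (hs z hz).2 (Or.inl h)⟩
  -- The move replaces a contribution of at least 2 to half the off-diagonal sum by at most 1, so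
  -- `Φ` drops.
  have hfin := hleast C' hC' (by rw [hS', Finset.card_insert_of_notMem he'T, hTcard])
  rw [hS', hST, hΦ] at hfin
  simp only [sum_sum_insert _ edgeWeight_comm heT, sum_sum_insert _ edgeWeight_comm he'T,
    edgeWeight_self] at hfin
  omega

end SimpleGraph

/-! ### Odd labels, and the choice between 2 and 4 -/

namespace SimpleGraph

variable {V : Type*} {G : SimpleGraph V}

/-- Odd labels for the colors up to `d`, and the labels `L` on the edges of color `d + 1`. -/
def relabel (C : Sym2 V → ℕ) (d : ℕ) (L : Sym2 V → ℕ) (e : Sym2 V) : ℕ :=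
  if C e = d + 1 then L e else 2 * C e - 1

variable [Fintype V] [DecidableRel G.Adj] {d : ℕ} {C : Sym2 V → ℕ}

/-- The sum of the labels at a vertex. -/
def vertexSum (G : SimpleGraph V) [DecidableRel G.Adj] (c : Sym2 V → ℕ) (v : V) : ℕ :=
  ∑ w ∈ G.neighborFinset v, c s(v, w)

theorem IsProperPairColoring.vertexSum_relabel_of_forall_ne
    (hC : G.IsProperPairColoring (d + 1) C) {x : V} (hd : G.degree x = d)
    (hx : ∀ w, G.Adj x w → C s(x, w) ≠ d + 1) (L : Sym2 V → ℕ) :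
    G.vertexSum (relabel C d L) x = ∑ i ∈ Finset.Icc 1 d, (2 * i - 1) := by
  classical
  rw [← hC.image_neighborFinset hd hx, Finset.sum_image (hC.injOn_neighborFinset x)]
  refine Finset.sum_congr rfl fun w hw => ?_
  rw [mem_neighborFinset] at hw
  simp [relabel, hx w hw]

/-- The number `m` is the color below `d + 1` that is missing at `x`. It does not depend on `L`, so
it is known before the labels are chosen. -/
theorem IsProperPairColoring.exists_vertexSum_relabel (hC : G.IsProperPairColoring (d + 1) C)
    (x : V) (hd : G.degree x = d) :
    ∃ m, 1 ≤ m ∧ ∀ y, G.Adj x y → C s(x, y) = d + 1 → ∀ L,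
      G.vertexSum (relabel C d L) x + (2 * m - 1) =
        (∑ i ∈ Finset.Icc 1 d, (2 * i - 1)) + L s(x, y) := by
  classical
  by_cases h : ∃ y, G.Adj x y ∧ C s(x, y) = d + 1
  · obtain ⟨y, hxy, hCxy⟩ := h
    obtain ⟨m, hm, him⟩ := hC.exists_image_neighborFinset_erase hd hxy hCxy
    refine ⟨m, (Finset.mem_Icc.1 hm).1, fun y' hxy' hCxy' L => ?_⟩
    obtain rfl : y = y' := by
      by_contra hne
      exact hC.ne hxy hxy' hne (hCxy.trans hCxy'.symm)
    have hy : y ∈ G.neighborFinset x := by simpa using hxy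
    have hinj : Set.InjOn (fun w => C s(x, w)) ((G.neighborFinset x).erase y) :=
      (hC.injOn_neighborFinset x).mono (by simp)
    have h1 : ∑ w ∈ (G.neighborFinset x).erase y, relabel C d L s(x, w) =
        ∑ i ∈ (Finset.Icc 1 d).erase m, (2 * i - 1) := by
      rw [← him, Finset.sum_image hinj]
      refine Finset.sum_congr rfl fun w hw => ?_
      rw [Finset.mem_erase, mem_neighborFinset] at hw
      have := hC.ne hw.2 hxy hw.1
      rw [hCxy] at this
      simp [relabel, this]
    have h2 : relabel C d L s(x, y) = L s(x, y) := by simp [relabel, hCxy]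
    rw [vertexSum, ← Finset.sum_erase_add _ _ hy, h1, h2,
      ← Finset.sum_erase_add _ (fun i => 2 * i - 1) hm]
    ring
  · push Not at h
    -- No edge of the last color at `x`: the claim is vacuous and 1 is a dummy.
    exact ⟨1, le_rfl, fun y hy hCy => absurd hCy (h y hy)⟩

/-- Two edges of the last color can be labelled so that the sums at their ends do not collide. -/
theorem IsProperPairColoring.exists_pair_labels (hC : G.IsProperPairColoring (d + 1) C)
    (hd : ∀ v, G.degree v = d) (hg : 7 ≤ G.egirth) {e₁ e₂ : Sym2 V} (he₁ : e₁ ∈ G.edgeSet)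
    (he₂ : e₂ ∈ G.edgeSet) (hC₁ : C e₁ = d + 1) (hC₂ : C e₂ = d + 1) (hne : e₁ ≠ e₂) :
    ∃ l₁ l₂ : ℕ, (l₁ = 2 ∨ l₁ = 4) ∧ (l₂ = 2 ∨ l₂ = 4) ∧ ∀ L : Sym2 V → ℕ, L e₁ = l₁ → L e₂ = l₂ →
      ∀ u v w, v ∈ e₁ → w ∈ e₂ → G.Adj u v → G.Adj u w →
        G.vertexSum (relabel C d L) v + 2 * relabel C d L s(u, w) ≠
          G.vertexSum (relabel C d L) w + 2 * relabel C d L s(u, v) := by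
  have hM := fun x => hC.exists_vertexSum_relabel x (hd x)
  choose M hM1 hM using hM
  set D := ∑ i ∈ Finset.Icc 1 d, (2 * i - 1) with hD
  have hdisj : ∀ v ∈ e₁, ∀ w ∈ e₂, v ≠ w := by
    rintro v hv _ hw rfl
    obtain ⟨a, rfl⟩ := hv
    obtain ⟨b, rfl⟩ := hw
    exact hC.ne he₁ he₂ (fun h => hne (congrArg (fun z => s(v, z)) h)) (hC₁.trans hC₂.symm)
  have hsum₁ : ∀ L v, v ∈ e₁ →
      G.vertexSum (relabel C d L) v + (2 * M v - 1) = D + L e₁ := by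
    rintro L v ⟨a, rfl⟩
    exact hM v a he₁ hC₁ L
  have hsum₂ : ∀ L v, v ∈ e₂ →
      G.vertexSum (relabel C d L) v + (2 * M v - 1) = D + L e₂ := by
    rintro L v ⟨a, rfl⟩
    exact hM v a he₂ hC₂ L
  by_cases hadj : ∃ v ∈ e₁, ∃ w ∈ e₂, G.Adj v w
  · obtain ⟨v₀, ⟨v₁, rfl⟩, w₀, ⟨w₁, rfl⟩, hvw⟩ := hadj
    have hv : G.Adj v₀ v₁ := he₁
    have hw : G.Adj w₀ w₁ := he₂
    have hn00 := hdisj v₀ (by simp) w₀ (by simp)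
    have hn01 := hdisj v₀ (by simp) w₁ (by simp)
    have hn10 := hdisj v₁ (by simp) w₀ (by simp)
    have hn11 := hdisj v₁ (by simp) w₁ (by simp)
    have hCvw : C s(v₀, w₀) ≠ d + 1 := by
      rw [← hC₁]
      exact hC.ne hvw hv hn10.symm
    -- By girth, `u` must be `v₀` or `w₀`. Each case forbids one value of `l₁ + l₂`, and the values
    -- 4, 6, 8 are available.
    obtain ⟨l₁, l₂, h1, h2, h3, h4⟩ : ∃ l₁ l₂ : ℕ, (l₁ = 2 ∨ l₁ = 4) ∧ (l₂ = 2 ∨ l₂ = 4) ∧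
        l₁ + l₂ + 2 * M v₁ ≠ 2 * (2 * C s(v₀, w₀) - 1) + 2 * M w₀ ∧
        l₁ + l₂ + 2 * M w₁ ≠ 2 * (2 * C s(v₀, w₀) - 1) + 2 * M v₀ := by
      by_contra! hcon
      have a := hcon 2 2 (by simp) (by simp)
      have b := hcon 2 4 (by simp) (by simp)
      have c := hcon 4 4 (by simp) (by simp)
      omega
    refine ⟨l₁, l₂, h1, h2, fun L hL₁ hL₂ u v w hv' hw' huv huw heq => ?_⟩
    have s1 := hsum₁ L v hv'
    have s2 := hsum₂ L w hw'
    have m1 := hM1 v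
    have m2 := hM1 w
    have lv : relabel C d L s(v₀, v₁) = l₁ := by simp [relabel, hC₁, hL₁]
    have lw : relabel C d L s(w₀, w₁) = l₂ := by simp [relabel, hC₂, hL₂]
    have lvw : relabel C d L s(v₀, w₀) = 2 * C s(v₀, w₀) - 1 := by simp [relabel, hCvw]
    rw [hL₁] at s1
    rw [hL₂] at s2
    rcases Sym2.mem_iff.1 hv' with rfl | rfl <;> rcases Sym2.mem_iff.1 hw' with rfl | rfl
    · exact not_triangle_of_egirth hg huv hvw huw
    · obtain rfl : u = w₀ :=
        eq_of_common_neighbors_of_egirth hg hn01 huv.symm huw hvw hw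
      rw [lw, show s(u, v) = s(v, u) from Sym2.eq_swap, lvw] at heq
      omega
    · obtain rfl : u = v₀ :=
        eq_of_common_neighbors_of_egirth hg hn10 huv.symm huw hv.symm hvw
      rw [lv, lvw] at heq
      omega
    · exact not_pentagon_of_egirth hg hv.symm hvw hw huv.symm huw hn10 hn11 hn01
  · push Not at hadj
    by_cases htr : ∃ u v w, v ∈ e₁ ∧ w ∈ e₂ ∧ G.Adj u v ∧ G.Adj u w
    · obtain ⟨u, v, w, hv, hw, huv, huw⟩ := htr
      -- Two different connections would close a cycle of length 4, 5 or 6.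
      have huniq : ∀ u' v' w', v' ∈ e₁ → w' ∈ e₂ → G.Adj u' v' → G.Adj u' w' →
          u' = u ∧ v' = v ∧ w' = w := by
        intro u' v' w' hv' hw' huv' huw'
        have hu1 : u ∉ e₁ := fun h => hadj u h w hw huw
        have hu2 : u ∉ e₂ := fun h => hadj v hv u h huv.symm
        have hu1' : u' ∉ e₁ := fun h => hadj u' h w' hw' huw'
        have hu2' : u' ∉ e₂ := fun h => hadj v' hv' u' h huv'.symm
        have n1 := hdisj v hv w hw
        have n2 := hdisj v hv w' hw'
        have n3 := hdisj v' hv' w hw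
        have n4 := hdisj v' hv' w' hw'
        by_cases hvv : v' = v
        · subst hvv
          by_cases hww : w' = w
          · subst hww
            exact ⟨eq_of_common_neighbors_of_egirth hg n1 huv'.symm huw' huv.symm huw, rfl, rfl⟩
          · exfalso
            have hadjw : G.Adj w w' := by
              have := (Sym2.mem_and_mem_iff (Ne.symm hww)).1 ⟨hw, hw'⟩
              rwa [this] at he₂
            exact not_pentagon_of_egirth hg huv.symm huw hadjw huv'.symm huw' n1 n2
              (fun h => hu2 (h ▸ hw'))
        · exfalso
          have hadjv : G.Adj v v' := by
            have := (Sym2.mem_and_mem_iff (Ne.symm hvv)).1 ⟨hv, hv'⟩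
            rwa [this] at he₁
          by_cases hww : w' = w
          · subst hww
            exact not_pentagon_of_egirth hg hadjv huv'.symm huw' huv.symm huw
              (fun h => hu1' (h ▸ hv)) n1 n3
          · have hadjw : G.Adj w w' := by
              have := (Sym2.mem_and_mem_iff (Ne.symm hww)).1 ⟨hw, hw'⟩
              rwa [this] at he₂
            have := eq_of_hexagon_of_egirth hg huv.symm huw hadjw hadjv huv'.symm huw' n1 n2
              (fun h => hu2 (h ▸ hw')) (fun h => hu1' (h ▸ hv)) n4
            exact hu1 (this ▸ hv')
      have hCuv : C s(u, v) ≠ d + 1 := by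
        obtain ⟨a, rfl⟩ := hv
        rw [← hC₁, Sym2.eq_swap]
        exact hC.ne huv.symm he₁ (fun h => hadj a (by simp) w hw (h ▸ huw))
      have hCuw : C s(u, w) ≠ d + 1 := by
        obtain ⟨a, rfl⟩ := hw
        rw [← hC₂, Sym2.eq_swap]
        exact hC.ne huw.symm he₂ (fun h => hadj v hv a (by simp) (h ▸ huv.symm))
      -- With a single connection and `l₁ = 2`, at most one value of `l₂` is forbidden.
      obtain ⟨l₂, h2, h3⟩ : ∃ l₂ : ℕ, (l₂ = 2 ∨ l₂ = 4) ∧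
          2 + 2 * M w + 2 * (2 * C s(u, w) - 1) ≠ l₂ + 2 * M v + 2 * (2 * C s(u, v) - 1) := by
        by_contra! hcon
        have a := hcon 2 (by simp)
        have b := hcon 4 (by simp)
        omega
      refine ⟨2, l₂, by simp, h2, fun L hL₁ hL₂ u' v' w' hv' hw' huv' huw' heq => ?_⟩
      obtain ⟨rfl, rfl, rfl⟩ := huniq u' v' w' hv' hw' huv' huw'
      have s1 := hsum₁ L v' hv'
      have s2 := hsum₂ L w' hw'
      have m1 := hM1 v'
      have m2 := hM1 w'
      have l1 : relabel C d L s(u', v') = 2 * C s(u', v') - 1 := by simp [relabel, hCuv]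
      have l2 : relabel C d L s(u', w') = 2 * C s(u', w') - 1 := by simp [relabel, hCuw]
      rw [l1, l2] at heq
      omega
    · exact ⟨2, 2, by simp, by simp, fun L _ _ u v w hv hw huv huw =>
        absurd ⟨u, v, w, hv, hw, huv, huw⟩ htr⟩

/-- A labelling of the last color class that separates the sums at the ends of its edges. -/
theorem IsProperPairColoring.exists_labels (hC : G.IsProperPairColoring (d + 1) C)
    (hd : ∀ v, G.degree v = d) (hg : 7 ≤ G.egirth)
    (hM : ∀ e ∈ G.colorClass C (d + 1), ∀ f ∈ G.colorClass C (d + 1),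
      ∀ g ∈ G.colorClass C (d + 1), f ≠ e → g ≠ e → G.EdgesNear e f → G.EdgesNear e g → f = g) :
    ∃ L : Sym2 V → ℕ, (∀ e, L e = 2 ∨ L e = 4) ∧
      ∀ e₁ ∈ G.colorClass C (d + 1), ∀ e₂ ∈ G.colorClass C (d + 1), e₁ ≠ e₂ →
        ∀ u v w, v ∈ e₁ → w ∈ e₂ → G.Adj u v → G.Adj u w →
          G.vertexSum (relabel C d L) v + 2 * relabel C d L s(u, w) ≠
            G.vertexSum (relabel C d L) w + 2 * relabel C d L s(u, v) := by
  classical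
  -- Choosing labels per unordered pair makes both edges of a near pair refer to the same choice.
  have hpair : ∀ p : Sym2 (Sym2 V), ∃ g : Sym2 V → ℕ, (∀ z, g z = 2 ∨ g z = 4) ∧
      ∀ e₁ ∈ G.colorClass C (d + 1), ∀ e₂ ∈ G.colorClass C (d + 1), e₁ ≠ e₂ → p = s(e₁, e₂) →
        ∀ L : Sym2 V → ℕ, L e₁ = g e₁ → L e₂ = g e₂ →
        ∀ u v w, v ∈ e₁ → w ∈ e₂ → G.Adj u v → G.Adj u w →
          G.vertexSum (relabel C d L) v + 2 * relabel C d L s(u, w) ≠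
            G.vertexSum (relabel C d L) w + 2 * relabel C d L s(u, v) := by
    intro p
    induction p with
    | h a b =>
    by_cases hab : a ∈ G.colorClass C (d + 1) ∧ b ∈ G.colorClass C (d + 1) ∧ a ≠ b
    · obtain ⟨ha, hb, hne⟩ := hab
      rw [mem_colorClass] at ha hb
      obtain ⟨l₁, l₂, h1, h2, h3⟩ := hC.exists_pair_labels hd hg ha.1 hb.1 ha.2 hb.2 hne
      refine ⟨fun z => if z = a then l₁ else l₂, fun z => ?_, ?_⟩
      · dsimp only
        split_ifs <;> assumption
      · intro e₁ _ e₂ _ _ hp L hL₁ hL₂ u v w hv hw huv huw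
        rcases Sym2.eq_iff.1 hp with ⟨rfl, rfl⟩ | ⟨rfl, rfl⟩
        · exact h3 L (by simpa using hL₁) (by simpa [hne.symm] using hL₂) u v w hv hw huv huw
        · exact (h3 L (by simpa using hL₂) (by simpa [hne.symm] using hL₁) u w v hw hv huw huv).symm
    · refine ⟨fun _ => 2, by simp, fun e₁ h₁ e₂ h₂ hne hp => absurd ?_ hab⟩
      rcases Sym2.eq_iff.1 hp with ⟨rfl, rfl⟩ | ⟨rfl, rfl⟩
      · exact ⟨h₁, h₂, hne⟩
      · exact ⟨h₂, h₁, hne.symm⟩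
  choose g hg24 hgood using hpair
  -- The near partner is unique, so `choose` finds it; edges without one get an arbitrary 2.
  set L : Sym2 V → ℕ := fun e =>
    if h : ∃ f, f ∈ G.colorClass C (d + 1) ∧ f ≠ e ∧ G.EdgesNear e f then g s(e, h.choose) e
    else 2 with hL
  have hLe : ∀ e ∈ G.colorClass C (d + 1), ∀ f ∈ G.colorClass C (d + 1), f ≠ e →
      G.EdgesNear e f → L e = g s(e, f) e := by
    intro e he f hf hfe hnear
    have h : ∃ f, f ∈ G.colorClass C (d + 1) ∧ f ≠ e ∧ G.EdgesNear e f := ⟨f, hf, hfe, hnear⟩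
    have hc : h.choose = f :=
      hM e he _ h.choose_spec.1 f hf h.choose_spec.2.1 hfe h.choose_spec.2.2 hnear
    simp only [hL, dif_pos h, hc]
  refine ⟨L, fun e => ?_, ?_⟩
  · simp only [hL]
    split_ifs
    · exact hg24 _ _
    · exact Or.inl rfl
  · intro e₁ h₁ e₂ h₂ hne u v w hv hw huv huw
    have hnear : G.EdgesNear e₁ e₂ :=
      ⟨v, hv, w, hw, Walk.cons huv.symm (Walk.cons huw Walk.nil), by simp⟩
    refine hgood s(e₁, e₂) e₁ h₁ e₂ h₂ hne rfl L (hLe e₁ h₁ e₂ h₂ hne.symm hnear) ?_ u v w hv hw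
      huv huw
    rw [hLe e₂ h₂ e₁ h₁ hne hnear.symm, Sym2.eq_swap]

end SimpleGraph

/-! ### From labels on pairs to additive edge colorings -/

namespace SimpleGraph

variable {V : Type*} {G : SimpleGraph V}

theorem IsProperPairColoring.isProperEdgeColoring {k : ℕ} {C : Sym2 V → ℕ}
    (hC : G.IsProperPairColoring k C) : G.IsProperEdgeColoring k fun e => C e := by
  constructor
  · rintro ⟨e, he⟩
    induction e with
    | h a b => exact ⟨hC.one_le he, hC.le he⟩
  · rintro ⟨e, he⟩ ⟨f, hf⟩ h
    obtain ⟨hne, v, ⟨a, rfl⟩, ⟨b, rfl⟩⟩ := lineGraph_adj_iff_exists.1 h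
    exact hC.ne he hf fun hab => hne (by simp [hab])

theorem IsProperEdgeColoring.exists_pairColoring {k : ℕ} {c : G.edgeSet → ℕ}
    (hc : G.IsProperEdgeColoring k c) :
    ∃ C, G.IsProperPairColoring k C ∧ c = fun e : G.edgeSet => C e := by
  classical
  refine ⟨fun e => if h : e ∈ G.edgeSet then c ⟨e, h⟩ else 0, ⟨?_, ?_, ?_⟩, ?_⟩
  · intro u v h
    have h' : s(u, v) ∈ G.edgeSet := h
    rw [dif_pos h']
    exact (hc.1 _).1
  · intro u v h
    have h' : s(u, v) ∈ G.edgeSet := h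
    rw [dif_pos h']
    exact (hc.1 _).2
  · intro u v w h₁ h₂ hne
    have h₁' : s(u, v) ∈ G.edgeSet := h₁
    have h₂' : s(u, w) ∈ G.edgeSet := h₂
    rw [dif_pos h₁', dif_pos h₂']
    refine hc.2 _ _ (lineGraph_adj_iff_exists.2 ⟨fun h => hne ?_, u, by simp, by simp⟩)
    exact Sym2.congr_right.1 (congrArg Subtype.val h)
  · funext e
    simp

theorem IsProperPairColoring.relabel {d : ℕ} {C : Sym2 V → ℕ}
    (hC : G.IsProperPairColoring (d + 1) C) (hd : 2 ≤ d)
    {L : Sym2 V → ℕ}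
    (hL : ∀ e, L e = 2 ∨ L e = 4) :
    G.IsProperPairColoring (2 * d) (relabel C d L) := by
  refine ⟨?_, ?_, ?_⟩
  · intro u v h
    have h1 := hC.one_le h
    have h2 := hL s(u, v)
    unfold SimpleGraph.relabel
    split_ifs <;> omega
  · intro u v h
    have h1 := hC.le h
    have h2 := hL s(u, v)
    unfold SimpleGraph.relabel
    split_ifs <;> omega
  · intro u v w h h' hne
    have h0 := hC.ne h h' hne
    have h1 := hC.one_le h
    have h1' := hC.one_le h'
    have h2 := hL s(u, v)
    have h2' := hL s(u, w)
    unfold SimpleGraph.relabel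
    split_ifs <;> omega

variable [Fintype V]

theorem ncard_eq_card_colorClass (C : Sym2 V → ℕ) (k : ℕ) :
    {e : G.edgeSet | C e = k}.ncard = (G.colorClass C k).card := by
  rw [← Set.ncard_image_of_injective _ Subtype.val_injective, ← Set.ncard_coe_finset]
  congr 1
  ext e
  simp [mem_colorClass, and_comm]

variable [DecidableRel G.Adj]

/-- An edge incident to `uv` meets exactly one of its ends, whereas `uv` itself is counted at both.
-/
theorem incidentEdgeSum_add {c : Sym2 V → ℕ} {u v : V} (h : G.Adj u v) :
    G.incidentEdgeSum (fun e => c e) ⟨s(u, v), h⟩ + 2 * c s(u, v) =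
      G.vertexSum c u + G.vertexSum c v := by
  classical
  set A : V → Finset (Sym2 V) := fun x => (G.neighborFinset x).image fun w => s(x, w) with hA
  have hAmem : ∀ x e, e ∈ A x ↔ e ∈ G.edgeSet ∧ x ∈ e := by
    intro x e
    simp only [hA, Finset.mem_image, mem_neighborFinset]
    constructor
    · rintro ⟨w, hw, rfl⟩
      exact ⟨hw, by simp⟩
    · rintro ⟨he, w, rfl⟩
      exact ⟨w, he, rfl⟩
  have hAsum : ∀ x, G.vertexSum c x = ∑ e ∈ A x, c e := by
    intro x
    rw [hA, Finset.sum_image (fun a _ b _ hab => Sym2.congr_right.1 hab), vertexSum]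
  have hinter : A u ∩ A v = {s(u, v)} := by
    ext e
    rw [Finset.mem_inter, hAmem, hAmem, Finset.mem_singleton]
    constructor
    · rintro ⟨⟨_, h1⟩, _, h2⟩
      exact (Sym2.mem_and_mem_iff h.ne).1 ⟨h1, h2⟩
    · rintro rfl
      exact ⟨⟨h, by simp⟩, h, by simp⟩
  have hmem : s(u, v) ∈ A u ∪ A v :=
    Finset.mem_union_left _ ((hAmem _ _).2 ⟨h, by simp⟩)
  have hsum : G.incidentEdgeSum (fun e => c e) ⟨s(u, v), h⟩ =
      ∑ e ∈ (A u ∪ A v).erase s(u, v), c e := by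
    unfold incidentEdgeSum
    refine Finset.sum_bij (fun e _ => e.1) ?_ ?_ ?_ ?_
    · intro e he
      obtain ⟨hne, x, hx, hxe⟩ := lineGraph_adj_iff_exists.1 (Finset.mem_filter.1 he).2
      refine Finset.mem_erase.2 ⟨fun h' => hne (Subtype.ext h'.symm), Finset.mem_union.2 ?_⟩
      rcases Sym2.mem_iff.1 hx with rfl | rfl
      · exact Or.inl ((hAmem _ _).2 ⟨e.2, hxe⟩)
      · exact Or.inr ((hAmem _ _).2 ⟨e.2, hxe⟩)
    · intro a _ b _ hab
      exact Subtype.ext hab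
    · intro e he
      obtain ⟨hne, he⟩ := Finset.mem_erase.1 he
      have : e ∈ G.edgeSet ∧ ∃ x ∈ s(u, v), x ∈ e := by
        rcases Finset.mem_union.1 he with he | he
        · exact ⟨((hAmem _ _).1 he).1, u, by simp, ((hAmem _ _).1 he).2⟩
        · exact ⟨((hAmem _ _).1 he).1, v, by simp, ((hAmem _ _).1 he).2⟩
      obtain ⟨heG, x, hx, hxe⟩ := this
      refine ⟨⟨e, heG⟩, ?_, rfl⟩
      simp only [Finset.mem_filter, Finset.mem_univ, true_and]
      exact lineGraph_adj_iff_exists.2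
        ⟨fun h' => hne (congrArg Subtype.val h').symm, x, hx, hxe⟩
    · intro e _
      rfl
  have h1 := Finset.sum_union_inter (s₁ := A u) (s₂ := A v) (f := c)
  rw [hinter, Finset.sum_singleton, ← Finset.sum_erase_add _ _ hmem] at h1
  rw [hsum, hAsum, hAsum, ← h1]
  ring

variable {d : ℕ} {C : Sym2 V → ℕ}

theorem IsProperPairColoring.isAdditive_relabel (hC : G.IsProperPairColoring (d + 1) C)
    (hdeg : ∀ v, G.degree v = d) (hd : 2 ≤ d) (hg : 7 ≤ G.egirth) {L : Sym2 V → ℕ}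
    (hL : ∀ e, L e = 2 ∨ L e = 4)
    (hsep : ∀ e₁ ∈ G.colorClass C (d + 1), ∀ e₂ ∈ G.colorClass C (d + 1), e₁ ≠ e₂ →
        ∀ u v w, v ∈ e₁ → w ∈ e₂ → G.Adj u v → G.Adj u w →
          G.vertexSum (SimpleGraph.relabel C d L) v + 2 * SimpleGraph.relabel C d L s(u, w) ≠
            G.vertexSum (SimpleGraph.relabel C d L) w + 2 * SimpleGraph.relabel C d L s(u, v)) :
    G.IsAdditiveEdgeColoring fun e => SimpleGraph.relabel C d L e := by
  rintro ⟨e, he⟩ ⟨f, hf⟩ hef heq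
  obtain ⟨hne, u, ⟨v, rfl⟩, ⟨w, rfl⟩⟩ := lineGraph_adj_iff_exists.1 hef
  have huv : G.Adj u v := he
  have huw : G.Adj u w := hf
  have hvw : v ≠ w := fun h => hne (by simp [h])
  have h1 := incidentEdgeSum_add (c := SimpleGraph.relabel C d L) huv
  have h2 := incidentEdgeSum_add (c := SimpleGraph.relabel C d L) huw
  have heq' : G.vertexSum (SimpleGraph.relabel C d L) v + 2 * SimpleGraph.relabel C d L s(u, w) =
      G.vertexSum (SimpleGraph.relabel C d L) w + 2 * SimpleGraph.relabel C d L s(u, v) := by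
    omega
  have hlab := (hC.relabel hd hL).ne huv huw hvw
  obtain ⟨m, hm, hmv⟩ := hC.exists_vertexSum_relabel v (hdeg v)
  obtain ⟨m', hm', hmw⟩ := hC.exists_vertexSum_relabel w (hdeg w)
  by_cases hv : ∃ y, G.Adj v y ∧ C s(v, y) = d + 1
  · obtain ⟨y, hvy, hCy⟩ := hv
    by_cases hw : ∃ z, G.Adj w z ∧ C s(w, z) = d + 1
    · obtain ⟨z, hwz, hCz⟩ := hw
      refine hsep s(v, y) (mem_colorClass.2 ⟨hvy, hCy⟩) s(w, z) (mem_colorClass.2 ⟨hwz, hCz⟩) ?_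
        u v w (by simp) (by simp) huv huw heq'
      intro h
      have hwy : w = y := by
        have : w ∈ s(v, y) := h ▸ Sym2.mem_mk_left w z
        simpa [hvw.symm] using this
      subst hwy
      exact not_triangle_of_egirth hg huv hvy huw
    · push Not at hw
      -- Parity: the sum at `v` differs from that at `w` by an even label minus an odd one, and the
      -- remaining terms are doubled.
      have a := hmv y hvy hCy L
      have b := hC.vertexSum_relabel_of_forall_ne (hdeg w) hw L
      have c := hL s(v, y)
      omega
  · push Not at hv
    have b := hC.vertexSum_relabel_of_forall_ne (hdeg v) hv L
    by_cases hw : ∃ z, G.Adj w z ∧ C s(w, z) = d + 1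
    · obtain ⟨z, hwz, hCz⟩ := hw
      have a := hmw z hwz hCz L
      have c := hL s(w, z)
      omega
    · push Not at hw
      have b' := hC.vertexSum_relabel_of_forall_ne (hdeg w) hw L
      omega

theorem isProperPairColoring_one (hdeg : ∀ v, G.degree v = d) (hd : d ≤ 1) :
    G.IsProperPairColoring (d + 1) fun _ => 1 := by
  refine ⟨fun _ => le_rfl, fun _ => by omega, fun {u v w} huv huw hvw => ?_⟩
  classical
  have h1 : ({v, w} : Finset V).card ≤ (G.neighborFinset u).card := by
    refine Finset.card_le_card fun z hz => ?_
    rw [mem_neighborFinset]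
    rcases Finset.mem_insert.1 hz with rfl | hz
    · exact huv
    · rwa [Finset.mem_singleton.1 hz]
  rw [Finset.card_pair hvw, card_neighborFinset_eq_degree, hdeg] at h1
  omega

theorem colorClass_one_eq_empty (hdeg : ∀ v, G.degree v = d) :
    G.colorClass (fun _ => 1) (d + 1) = ∅ := by
  rw [Finset.eq_empty_iff_forall_notMem]
  intro e he
  obtain ⟨he, h1⟩ := mem_colorClass.1 he
  induction e with
  | h u v =>
    have : 0 < G.degree u := (G.degree_pos_iff_exists_adj u).2 ⟨v, he⟩
    rw [hdeg] at this
    omega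

end SimpleGraph

/-! ### The bound on the proper additive chromatic index -/

open SimpleGraph in
theorem mainTheorem3 {V : Type*} [Fintype V] (G : SimpleGraph V) [DecidableRel G.Adj]
    (d r : ℕ) (hG : G.IsRegularVizingClassTwo d) (hres : G.resistance d = r) (hr : 2 ≤ r)
    (hgirth : ((6 * r - 5 : ℕ) : ℕ∞) ≤ G.egirth) :
    G.properAdditiveChromaticIndex ≤ 2 * (d : ℕ∞) ∧
      2 * (d : ℕ∞) = 2 * G.edgeChromaticIndex - 2 := by
  obtain ⟨hreg, hχ⟩ := hG
  have hdeg : ∀ v, G.degree v = d := hreg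
  refine ⟨?_, ?_⟩
  · have hcol : G.lineGraph.Colorable (d + 1) := by
      rw [← chromaticNumber_le_iff_colorable]
      exact_mod_cast hχ.le
    obtain ⟨κ⟩ := hcol
    -- Nonemptiness ensures that the infimum defining the resistance is attained.
    have hne : {m : ℕ | ∃ c : G.edgeSet → ℕ, G.IsProperEdgeColoring (d + 1) c ∧
        {e : G.edgeSet | c e = d + 1}.ncard = m}.Nonempty := by
      refine ⟨_, fun e => (κ e : ℕ) + 1, ⟨fun e => ⟨Nat.le_add_left _ _, (κ e).2⟩, ?_⟩, rfl⟩
      intro e f hef h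
      exact κ.valid hef (Fin.ext (by simpa using h))
    have hex : ∃ C, G.IsProperPairColoring (d + 1) C ∧ (G.colorClass C (d + 1)).card = r := by
      obtain ⟨c, hc, hcard⟩ := Nat.sInf_mem hne
      obtain ⟨C, hC, rfl⟩ := hc.exists_pairColoring
      exact ⟨C, hC, by rw [← ncard_eq_card_colorClass, hcard, ← hres, resistance]⟩
    have hmin : ∀ C, G.IsProperPairColoring (d + 1) C → r ≤ (G.colorClass C (d + 1)).card := by
      intro C hC
      rw [← hres, resistance]
      exact Nat.sInf_le ⟨_, hC.isProperEdgeColoring, ncard_eq_card_colorClass C (d + 1)⟩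
    -- Needed for the label 4 to be at most `2 * d`. For `d ≤ 1` the constant coloring has an empty
    -- last class, against `r ≥ 2`.
    have hd : 2 ≤ d := by
      by_contra hd
      have := hmin _ (isProperPairColoring_one hdeg (by omega))
      rw [colorClass_one_eq_empty hdeg] at this
      simp at this
      omega
    have hg : 7 ≤ G.egirth := le_trans (by exact_mod_cast (by omega : 7 ≤ 6 * r - 5)) hgirth
    obtain ⟨C, hC, hM⟩ := exists_coloring_near_matching hdeg hmin hex hgirth
    obtain ⟨L, hL, hsep⟩ := hC.exists_labels hdeg hg hM
    refine (iInf₂_le (2 * d) ⟨_, (hC.relabel hd hL).isProperEdgeColoring,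
      hC.isAdditive_relabel hdeg hd hg hL hsep⟩).trans ?_
    push_cast
    exact le_rfl
  · rw [hχ]
    norm_cast
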